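/- Let $\theta_t\in\{0,1\}$ and real observations $X_t$, $t=1,2,\dots$, follow the two-group model: $\theta_t\sim\mathrm{Bernoulli}(\pi_t)$; given $\theta_t=0$ (resp. $\theta_t=1$), $X_t$ has density $f_0$ (resp. $f_{1t}$); and $X_1,X_2,\dots$ are independent. Put $f_t=(1-\pi_t)f_0+\pi_tf_{1t}$. (Here $f_0$ always denotes the null density, and time indices start at $1$.) Let $p:\mathbb R\to[0,1]$ be a p-value function (measurable, with $p(X)$ uniform on $[0,1]$ if $X$ has density $f_0$), $P_t=p(X_t)$ and $\tau\in[0,1)$. Define $$\pi_t^\tau=1-\frac{\mathbb P(P_t>\tau)}{1-\tau},\qquad \mathrm{Clfdr}_t^\tau=\frac{(1-\pi_t^\tau)f_0(X_t)}{f_t(X_t)}.$$ Let $K\ge 0$ be a measurable kernel with $\int K=1$, $\int uK(u)\,du=0$, $\int u^2K(u)\,du<\infty$, which is bounded below by a positive constant near $0$ and satisfies $K(u)\le G(|u|)$ for some integrable nonincreasing $G$ on $[0,\infty)$; write $K_h(u)=h^{-1}K(u/h)$. For bandwidths $h_t>0$, $h_x=h_x(t)>0$ and window lengths $d=d(t)\in\mathbb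 N$, $d\le t$, define $$\hat f_t(x)=\frac{\sum_{j=t-d+1}^{t-1}K_{h_t}(j-t)K_{h_x}(X_j-x)}{\sum_{j=t-d+1}^{t-1}K_{h_t}(j-t)},\qquad \hat\pi_t^\tau=1-\frac{\sum_{t-d+1\le i\le t-1,\;P_i>\tau}K_{h_t}(t-i)}{(1-\tau)\sum_{i=t-d+1}^{t-1}K_{h_t}(t-i)},$$ $$\hat\rho_t=\frac{(1-\hat\pi_t^\tau)f_0(X_t)}{\hat f_t(X_t)},\qquad \widehat{\mathrm{Clfdr}}_t=\min\{\hat\rho_t,1\}.$$ Suppose that the laws of $X_1,X_2,\dots$ are tight (for every $\epsilon>0$ there is $M$ with $\int_{|x|>M}f_t(x)\,dx<\epsilon$ for all $t\ge1$), and that: (A1') for every $\epsilon>0$ there is $T$ such that for all $t>T$ and all integers $i,j\ge 1$ in $[\lfloor t-\sqrt{\log t}\,h_t\rfloor,\,t]$, $\int|f_i(x)-f_j(x)|\,dx<\epsilon$; (A2') $h_x\to0$, $h_t\le t$ and $h_xh_t\to\infty$ as $t\to\infty$; (A3') there is $C$ such that, for all $j\ge1$, $f_j$ is twice differentiable, $f_j(x)<C$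 for all $x$, and $\int|f_j''(x)|\,dx<C$; (A4') there is $c>0$ with $d\ge c\,h_t$ for all $t\ge1$. Then, as $t\to\infty$, $$\widehat{\mathrm{Clfdr}}_t-\min\{\mathrm{Clfdr}_t^\tau,1\}\xrightarrow{p}0\qquad\text{and}\qquad \hat\rho_t-\mathrm{Clfdr}_t^\tau\xrightarrow{p}0 .$$ In particular, if $\mathbb P(\mathrm{Clfdr}_t^\tau>1+\epsilon)\to0$ for every $\epsilon>0$, then $\widehat{\mathrm{Clfdr}}_t-\mathrm{Clfdr}_t^\tau\xrightarrow{p}0$. -/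

import Mathlib

open MeasureTheory ProbabilityTheory Filter Topology

/-- `f` is a probability density on the real line. -/
structure IsDensity (f : ℝ → ℝ) : Prop where
  measurable : Measurable f
  nonneg : ∀ x, 0 ≤ f x
  integrable : Integrable f
  integral_eq_one : ∫ x, f x = 1

/-- Smoothing kernels: probability densities with mean zero and finite second moment, bounded away
from zero near the origin and dominated by an integrable function which is nonincreasing in `|u|`. -/
structure IsKernel (K : ℝ → ℝ) : Prop where
  density : IsDensity K
  integrable_mul : Integrable (fun u => u * K u)
  integral_mul : ∫ u, u * K u = 0
  integrable_sq_mul : Integrable (fun u => u ^ 2 * K u)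
  pos_near_zero : ∃ δ > 0, ∃ κ > 0, ∀ u, |u| ≤ δ → κ ≤ K u
  dominated : ∃ G : ℝ → ℝ, AntitoneOn G (Set.Ici 0) ∧ IntegrableOn G (Set.Ici 0) ∧
    ∀ u, K u ≤ G |u|

/-- The rescaled kernel `K_h(u) = h⁻¹ K(u / h)`. -/
noncomputable def scaledKernel (K : ℝ → ℝ) (h u : ℝ) : ℝ := h⁻¹ * K (u / h)

/-- The marginal density `f_t = (1 - π_t) f₀ + π_t f_{1t}`. -/
noncomputable def mixDensity (f₀ : ℝ → ℝ) (f₁ : ℕ → ℝ → ℝ) (π : ℕ → ℝ) (t : ℕ) (x : ℝ) : ℝ :=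
  (1 - π t) * f₀ x + π t * f₁ t x

/-- The hierarchical two-group model on the times `t = 1, 2, …`: `θ_t` is Bernoulli with
`P(θ_t = 1) = π_t` (with `true` for `1`, i.e. for a false null hypothesis), given `θ_t = 0` the
observation `X_t` has density `f₀`, given `θ_t = 1` it has density `f_{1t}`, and the observations
`X_1, X_2, …` are independent. -/
structure IsTwoGroupModel {Ω : Type*} [MeasurableSpace Ω] (μ : Measure Ω)
    (θ : ℕ → Ω → Bool) (X : ℕ → Ω → ℝ) (f₀ : ℝ → ℝ) (f₁ : ℕ → ℝ → ℝ) (π : ℕ → ℝ) : Prop where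
  measurable_theta : ∀ t, 1 ≤ t → Measurable (θ t)
  measurable_obs : ∀ t, 1 ≤ t → Measurable (X t)
  density_null : IsDensity f₀
  density_alt : ∀ t, 1 ≤ t → IsDensity (f₁ t)
  prop_mem : ∀ t, 1 ≤ t → π t ∈ Set.Icc (0 : ℝ) 1
  law_null : ∀ t, 1 ≤ t → ∀ A : Set ℝ, MeasurableSet A →
    μ {ω | θ t ω = false ∧ X t ω ∈ A}
      = ENNReal.ofReal (1 - π t) * ∫⁻ x in A, ENNReal.ofReal (f₀ x)
  law_alt : ∀ t, 1 ≤ t → ∀ A : Set ℝ, MeasurableSet A →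
    μ {ω | θ t ω = true ∧ X t ω ∈ A}
      = ENNReal.ofReal (π t) * ∫⁻ x in A, ENNReal.ofReal (f₁ t x)
  indep : iIndepFun (fun t : ℕ => X (t + 1)) μ

/-- `p` is a p-value function for the null density `f₀`: it takes values in `[0, 1]` and `p(X)` is
uniform on `[0, 1]` when `X` has density `f₀`. -/
structure IsPValue (f₀ p : ℝ → ℝ) : Prop where
  measurable : Measurable p
  mem_Icc : ∀ x, p x ∈ Set.Icc (0 : ℝ) 1
  uniform : (volume.withDensity (fun x => ENNReal.ofReal (f₀ x))).map p
    = volume.restrict (Set.Icc (0 : ℝ) 1)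

/-- The indices `t - d + 1, …, t - 1` of the past observations in the moving window
(used with `d ≤ t`). -/
def pastWindow (t d : ℕ) : Finset ℕ := Finset.Icc (t + 1 - d) (t - 1)

/-- The kernel density estimator `f̂_t(x)`, computed from the data sequence `z`. -/
noncomputable def densityEst (K : ℝ → ℝ) (ht hx : ℕ → ℝ) (d : ℕ → ℕ) (z : ℕ → ℝ) (t : ℕ)
    (x : ℝ) : ℝ :=
  (∑ j ∈ pastWindow t (d t),
      scaledKernel K (ht t) ((j : ℝ) - (t : ℝ)) * scaledKernel K (hx t) (z j - x))
    / ∑ j ∈ pastWindow t (d t), scaledKernel K (ht t) ((j : ℝ) - (t : ℝ))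

open Classical in
/-- The screening estimator `π̂_t^τ`, computed from the data sequence `z`; the sum in the numerator
runs over the indices of the window with p-value larger than `τ`. -/
noncomputable def propEst (K : ℝ → ℝ) (ht : ℕ → ℝ) (d : ℕ → ℕ) (p : ℝ → ℝ) (τ : ℝ) (z : ℕ → ℝ)
    (t : ℕ) : ℝ :=
  1 - (∑ i ∈ (pastWindow t (d t)).filter (fun i => τ < p (z i)),
        scaledKernel K (ht t) ((t : ℝ) - (i : ℝ)))
      / ((1 - τ) * ∑ i ∈ pastWindow t (d t), scaledKernel K (ht t) ((t : ℝ) - (i : ℝ)))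

/-- The plug-in ratio `(1 - π̂_t^τ) f₀(x_t) / f̂_t(x_t)`, before truncation at `1`. -/
noncomputable def clfdrRatioEst (f₀ K : ℝ → ℝ) (ht hx : ℕ → ℝ) (d : ℕ → ℕ) (p : ℝ → ℝ) (τ : ℝ)
    (z : ℕ → ℝ) (t : ℕ) : ℝ :=
  (1 - propEst K ht d p τ z t) * f₀ (z t) / densityEst K ht hx d z t (z t)

/-- The estimator `min {(1 - π̂_t^τ) f₀(x_t) / f̂_t(x_t), 1}` of the conditional local fdr. -/
noncomputable def clfdrEst (f₀ K : ℝ → ℝ) (ht hx : ℕ → ℝ) (d : ℕ → ℕ) (p : ℝ → ℝ) (τ : ℝ)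
    (z : ℕ → ℝ) (t : ℕ) : ℝ :=
  min (clfdrRatioEst f₀ K ht hx d p τ z t) 1

/-- `π_t^τ = 1 - (1 - τ)⁻¹ P(P_t > τ)`, where `P_t = p(X_t)`. -/
noncomputable def propTau {Ω : Type*} [MeasurableSpace Ω] (μ : Measure Ω) (X : ℕ → Ω → ℝ)
    (p : ℝ → ℝ) (τ : ℝ) (t : ℕ) : ℝ :=
  1 - (1 - τ)⁻¹ * μ.real {ω | τ < p (X t ω)}

/-- The random variable `Clfdr_t^τ = (1 - π_t^τ) f₀(X_t) / f_t(X_t)`. -/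
noncomputable def clfdrTau {Ω : Type*} [MeasurableSpace Ω] (μ : Measure Ω) (X : ℕ → Ω → ℝ)
    (f₀ : ℝ → ℝ) (f₁ : ℕ → ℝ → ℝ) (π : ℕ → ℝ) (p : ℝ → ℝ) (τ : ℝ) (t : ℕ) (ω : Ω) : ℝ :=
  (1 - propTau μ X p τ t) * f₀ (X t ω) / mixDensity f₀ f₁ π t (X t ω)

/-! Both estimators are weighted means over past observations. The normalized weights are of order
at most `1 / ht t`, and all but a small share of their mass lies within a fixed number `A` of
bandwidths of the present. Since `√(log t)` eventually exceeds `A`, that mass sits where `f j` is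
L¹-close to `f t`, which controls the bias due to drift; Chebyshev's inequality controls the
fluctuations.

For `propEst` the summands are indicators, so L¹-closeness suffices and the variance is of order `1
/ ht t`. For `densityEst` the summands have height of order `1 / hx t` but bounded mean, so the
variance is of order `1 / (hx t * ht t)`. The densities are uniformly Lipschitz, hence the smoothing
bias is of order `hx t`, and L¹-closeness upgrades to uniform closeness. The error bound is
therefore uniform in `x`, and as `X t` is independent of the past, Fubini allows `x = X t`.

The ratio may be badly conditioned: `f₀` need not be bounded, nor `f t` bounded below. Outside
events of small probability, however, tightness gives `f t (X t) ≥ η` and a Markov bound gives `f₀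
(X t) ≤ M * f t (X t)`; there the ratio depends stably on the two estimates. Truncation at `1` is
1-Lipschitz. -/

/-! ### Lipschitz densities: from L¹ to uniform bounds. -/

/-- A bounded differentiable function with integrable second derivative is Lipschitz. -/
theorem abs_sub_le_of_integral_abs_deriv_deriv_le {f : ℝ → ℝ} {C : ℝ} (h0 : ∀ x, 0 ≤ f x)
    (hC : ∀ x, f x ≤ C) (hf : Differentiable ℝ f) (hf' : Differentiable ℝ (deriv f))
    (hint : Integrable (deriv (deriv f))) (hle : ∫ x, |deriv (deriv f) x| ≤ C) (x y : ℝ) :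
    |f x - f y| ≤ 2 * C * |x - y| := by
  have hosc : ∀ a b : ℝ, |deriv f b - deriv f a| ≤ C := by
    intro a b
    rw [← intervalIntegral.integral_eq_sub_of_hasDerivAt
      (fun z _ => (hf' z).hasDerivAt) hint.intervalIntegrable]
    refine le_trans ?_ hle
    have hnorm := intervalIntegral.norm_integral_le_integral_norm_uIoc
      (f := deriv (deriv f)) (a := a) (b := b) (μ := volume)
    refine hnorm.trans ?_
    exact setIntegral_le_integral hint.abs (Eventually.of_forall fun _ => abs_nonneg _)
  -- Some slope on `[x, x + 1]` is at most `C` in size because `f` takes values in `[0, C]`; the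
  -- oscillation of `deriv f` adds at most another `C`.
  have hderiv : ∀ x, |deriv f x| ≤ 2 * C := by
    intro x
    obtain ⟨c, -, hc⟩ := exists_deriv_eq_slope f (lt_add_one x) hf.continuous.continuousOn
      hf.differentiableOn
    have h1 : |deriv f c| ≤ C := by
      rw [hc, add_sub_cancel_left, div_one, abs_le]
      constructor <;> linarith [h0 x, h0 (x + 1), hC x, hC (x + 1)]
    have h2 := abs_add_le (deriv f x - deriv f c) (deriv f c)
    rw [sub_add_cancel] at h2
    linarith [hosc c x]
  exact Convex.norm_image_sub_le_of_norm_deriv_le (fun z _ => hf z)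
    (fun z _ => hderiv z) convex_univ (Set.mem_univ y) (Set.mem_univ x)

/-- A Lipschitz function which is small in `L¹` is uniformly small. -/
theorem abs_lt_of_integral_abs_lt {g : ℝ → ℝ} {L a : ℝ} (hL : 0 < L) (ha : 0 < a)
    (hg : ∀ x y, |g x - g y| ≤ L * |x - y|) (hint : Integrable g)
    (hsmall : ∫ x, |g x| < a ^ 2 / (4 * L)) (x : ℝ) : |g x| < a := by
  by_contra! hx
  -- A value of size `a` decays to no less than `a / 2` over a length `a / (2 * L)`, so the integral
  -- is at least `a ^ 2 / (4 * L)`.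
  have hlow : ∀ y ∈ Set.Ioc x (x + a / (2 * L)), a / 2 ≤ |g y| := by
    intro y hy
    have h1 := hg x y
    have h2 := abs_sub_abs_le_abs_sub (g x) (g y)
    have h3 : L * |x - y| ≤ a / 2 := by
      rw [abs_sub_comm, abs_of_pos (sub_pos.2 hy.1)]
      calc L * (y - x) ≤ L * (a / (2 * L)) := by gcongr; linarith [hy.2]
        _ = a / 2 := by field_simp
    linarith
  have h1 : ∫ _ in Set.Ioc x (x + a / (2 * L)), a / 2
      ≤ ∫ y in Set.Ioc x (x + a / (2 * L)), |g y| :=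
    setIntegral_mono_on (by simp) hint.abs.integrableOn measurableSet_Ioc hlow
  have h2 : ∫ y in Set.Ioc x (x + a / (2 * L)), |g y| ≤ ∫ y, |g y| :=
    setIntegral_le_integral hint.abs (Eventually.of_forall fun _ => abs_nonneg _)
  rw [setIntegral_const, Real.volume_real_Ioc_of_le (by simp; positivity), smul_eq_mul] at h1
  have h3 : (x + a / (2 * L) - x) * (a / 2) = a ^ 2 / (4 * L) := by field_simp; ring
  linarith

/-! ### Kernel weights on the moving window. -/

/-- Tail integrals of an integrable function on `[0, ∞)` are small. -/
theorem exists_intervalIntegral_tail_le {G : ℝ → ℝ} (hG : IntegrableOn G (Set.Ici 0)) {ε : ℝ}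
    (hε : 0 < ε) : ∃ A : ℝ, 0 ≤ A ∧ ∀ a b, A ≤ a → a ≤ b → ∫ u in a..b, G u ≤ ε := by
  have hG' : IntegrableOn G (Set.Ioi 0) := hG.mono_set Set.Ioi_subset_Ici_self
  have ht := intervalIntegral_tendsto_integral_Ioi 0 hG' tendsto_id
  obtain ⟨A, hA⟩ := Metric.tendsto_atTop.1 ht (ε / 2) (half_pos hε)
  refine ⟨max A 0, le_max_right _ _, fun a b ha hab => ?_⟩
  have h1 := hA a ((le_max_left _ _).trans ha)
  have h2 := hA b (((le_max_left _ _).trans ha).trans hab)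
  have ha0 : 0 ≤ a := (le_max_right _ _).trans ha
  have hii : ∀ {c}, 0 ≤ c → IntervalIntegrable G volume 0 c := fun {c} hc =>
    (intervalIntegrable_iff_integrableOn_Ioc_of_le hc).2 (hG'.mono_set Set.Ioc_subset_Ioi_self)
  have h3 := intervalIntegral.integral_add_adjacent_intervals (hii ha0)
    ((hii ha0).symm.trans (hii (ha0.trans hab)))
  rw [Real.dist_eq, abs_lt] at h1 h2
  simp only [id] at h1 h2
  linarith [h1.1, h2.2]

/-- The properties of a kernel that determine the behaviour of its weights on a moving window. -/
structure IsWindowKernel (K : ℝ → ℝ) : Prop where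
  nonneg : ∀ u, 0 ≤ K u
  pos_near_zero : ∃ δ > 0, ∃ κ > 0, ∀ u, |u| ≤ δ → κ ≤ K u
  dominated : ∃ G : ℝ → ℝ, AntitoneOn G (Set.Ici 0) ∧ IntegrableOn G (Set.Ici 0) ∧
    ∀ u, K u ≤ G |u|

theorem IsKernel.isWindowKernel {K : ℝ → ℝ} (hK : IsKernel K) : IsWindowKernel K :=
  ⟨hK.density.nonneg, hK.pos_near_zero, hK.dominated⟩

/-- `densityEst` weights by `K (j - t)` and `propEst` by `K (t - i)`. No symmetry of `K` is assumed,
so the second is treated through the reflected kernel. -/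
theorem IsWindowKernel.comp_neg {K : ℝ → ℝ} (hK : IsWindowKernel K) :
    IsWindowKernel (fun u => K (-u)) := by
  obtain ⟨δ, hδ, κ, hκ, h⟩ := hK.pos_near_zero
  obtain ⟨G, h1, h2, h3⟩ := hK.dominated
  exact ⟨fun u => hK.nonneg _, ⟨δ, hδ, κ, hκ, fun u hu => h _ (by rwa [abs_neg])⟩,
    ⟨G, h1, h2, fun u => by simpa using h3 (-u)⟩⟩

theorem IsWindowKernel.exists_bound {K : ℝ → ℝ} (hK : IsWindowKernel K) :
    ∃ B > 0, ∀ u, K u ≤ B := by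
  obtain ⟨G, h1, -, h3⟩ := hK.dominated
  refine ⟨max (G 0) 1, lt_max_of_lt_right one_pos, fun u => (h3 u).trans ?_⟩
  exact (h1 Set.self_mem_Ici (abs_nonneg u) (abs_nonneg u)).trans (le_max_left _ _)

theorem IsWindowKernel.scaledKernel_nonneg {K : ℝ → ℝ} (hK : IsWindowKernel K) {h : ℝ}
    (hh : 0 < h) (u : ℝ) : 0 ≤ scaledKernel K h u :=
  mul_nonneg (inv_nonneg.2 hh.le) (hK.nonneg _)

/-- The normalized kernel weight of the time `j` in the window before `t`. -/
noncomputable def windowWeight (K : ℝ → ℝ) (ht : ℕ → ℝ) (d : ℕ → ℕ) (t j : ℕ) : ℝ :=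
  scaledKernel K (ht t) ((j : ℝ) - t)
    / ∑ i ∈ pastWindow t (d t), scaledKernel K (ht t) ((i : ℝ) - t)

theorem mem_pastWindow {t d j : ℕ} (hd : d ≤ t) (hj : j ∈ pastWindow t d) :
    1 ≤ j ∧ j ≤ t - 1 ∧ j < t := by
  simp only [pastWindow, Finset.mem_Icc] at hj
  omega

section Weights

variable {K : ℝ → ℝ} {ht : ℕ → ℝ} {d : ℕ → ℕ}

theorem windowWeight_nonneg (hK : IsWindowKernel K) {t : ℕ} (hpos : 0 < ht t) (j : ℕ) :
    0 ≤ windowWeight K ht d t j :=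
  div_nonneg (hK.scaledKernel_nonneg hpos _)
    (Finset.sum_nonneg fun _ _ => hK.scaledKernel_nonneg hpos _)

/-- The total kernel mass of the window stays away from zero. -/
theorem exists_le_sum_scaledKernel (hK : IsWindowKernel K) (hd : ∀ t, d t ≤ t)
    (hlim : Tendsto ht atTop atTop) {c : ℝ} (hc : 0 < c) (hcd : ∀ t, 1 ≤ t → c * ht t ≤ d t) :
    ∃ s > 0, ∀ᶠ t in atTop,
      s ≤ ∑ i ∈ pastWindow t (d t), scaledKernel K (ht t) ((i : ℝ) - t) := by
  obtain ⟨δ, hδ, κ, hκ, hnear⟩ := hK.pos_near_zero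
  -- The last `k = ⌊b * ht t⌋` times each have raw weight at least `κ / ht t`, since `b ≤ δ`. The
  -- window has only `d t - 1` times; `b ≤ c / 2` and `ht t ≥ 2 / c` leave room for the missing one,
  -- and `ht t ≥ 2 / b` gives `k ≥ b * ht t / 2`.
  set b := min δ (c / 2) with hb
  have hb0 : 0 < b := lt_min hδ (half_pos hc)
  refine ⟨κ * b / 2, by positivity, ?_⟩
  filter_upwards [hlim.eventually_ge_atTop (2 / c), hlim.eventually_ge_atTop (2 / b),
    hlim.eventually_gt_atTop 0, eventually_ge_atTop 1] with t h1 h2 hpos ht1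
  rw [div_le_iff₀ hc] at h1
  rw [div_le_iff₀ hb0] at h2
  have hk := Nat.floor_le (show 0 ≤ b * ht t by positivity)
  have hk' := Nat.lt_floor_add_one (b * ht t)
  set k := ⌊b * ht t⌋₊ with hkdef
  have hbc : b * ht t ≤ c / 2 * ht t := by gcongr; exact min_le_right _ _
  have hkd : (k : ℝ) + 1 ≤ d t := by linarith [hcd t ht1]
  have hkd' : k + 1 ≤ d t := by exact_mod_cast hkd
  have hdt := hd t
  have hsub : Finset.Icc (t - k) (t - 1) ⊆ pastWindow t (d t) :=
    Finset.Icc_subset_Icc (by omega) le_rfl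
  refine le_trans ?_ (Finset.sum_le_sum_of_subset_of_nonneg hsub
    fun _ _ _ => hK.scaledKernel_nonneg hpos _)
  have hterm : ∀ i ∈ Finset.Icc (t - k) (t - 1),
      (ht t)⁻¹ * κ ≤ scaledKernel K (ht t) ((i : ℝ) - t) := by
    intro i hi
    rw [Finset.mem_Icc] at hi
    have hi1 : (t : ℝ) ≤ i + k := by exact_mod_cast (by omega : t ≤ i + k)
    have hi2 : (i : ℝ) ≤ t := by exact_mod_cast (by omega : i ≤ t)
    refine mul_le_mul_of_nonneg_left (hnear _ ?_) (inv_nonneg.2 hpos.le)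
    rw [abs_div, abs_of_pos hpos, div_le_iff₀ hpos, abs_sub_comm, abs_of_nonneg (by linarith)]
    have : b * ht t ≤ δ * ht t := by gcongr; exact min_le_left _ _
    linarith
  refine le_trans ?_ (Finset.card_nsmul_le_sum _ _ _ hterm)
  have hcard : (Finset.Icc (t - k) (t - 1)).card = k := by rw [Nat.card_Icc]; omega
  rw [hcard, nsmul_eq_mul]
  calc κ * b / 2 = (b * ht t / 2) * ((ht t)⁻¹ * κ) := by field_simp
    _ ≤ k * ((ht t)⁻¹ * κ) := by gcongr; linarith

theorem eventually_sum_windowWeight (hK : IsWindowKernel K) (hd : ∀ t, d t ≤ t)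
    (hlim : Tendsto ht atTop atTop) {c : ℝ} (hc : 0 < c) (hcd : ∀ t, 1 ≤ t → c * ht t ≤ d t) :
    ∀ᶠ t in atTop, ∑ j ∈ pastWindow t (d t), windowWeight K ht d t j = 1 := by
  obtain ⟨s, hs, h⟩ := exists_le_sum_scaledKernel hK hd hlim hc hcd
  filter_upwards [h] with t h
  simp only [windowWeight]
  rw [← Finset.sum_div]
  exact div_self (hs.trans_le h).ne'

/-- A raw weight is at most `B / ht t` and the total mass stays above `s`. This bound on the largest
weight drives the variance estimates. -/
theorem exists_windowWeight_le (hK : IsWindowKernel K) (hd : ∀ t, d t ≤ t)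
    (hlim : Tendsto ht atTop atTop) {c : ℝ} (hc : 0 < c) (hcd : ∀ t, 1 ≤ t → c * ht t ≤ d t) :
    ∃ D > 0, ∀ᶠ t in atTop, ∀ j, windowWeight K ht d t j ≤ D / ht t := by
  obtain ⟨s, hs, h⟩ := exists_le_sum_scaledKernel hK hd hlim hc hcd
  obtain ⟨B, hB, hKB⟩ := hK.exists_bound
  refine ⟨B / s, by positivity, ?_⟩
  filter_upwards [h, hlim.eventually_gt_atTop 0] with t h hpos j
  calc windowWeight K ht d t j ≤ ((ht t)⁻¹ * B) / s := by
        refine div_le_div₀ (by positivity) ?_ hs h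
        exact mul_le_mul_of_nonneg_left (hKB _) (inv_nonneg.2 hpos.le)
    _ = B / s / ht t := by field_simp

/-- Most of the weight of the window lies within a fixed number of bandwidths. -/
theorem exists_sum_windowWeight_far_le (hK : IsWindowKernel K) (hd : ∀ t, d t ≤ t)
    (hlim : Tendsto ht atTop atTop) {c : ℝ} (hc : 0 < c) (hcd : ∀ t, 1 ≤ t → c * ht t ≤ d t)
    {ε : ℝ} (hε : 0 < ε) :
    ∃ A : ℝ, ∀ᶠ t : ℕ in atTop,
      ∑ j ∈ (pastWindow t (d t)).filter (fun j : ℕ => (j : ℝ) < t - A * ht t),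
        windowWeight K ht d t j ≤ ε := by
  obtain ⟨s, hs, h⟩ := exists_le_sum_scaledKernel hK hd hlim hc hcd
  obtain ⟨G, hGanti, hGint, hKG⟩ := hK.dominated
  obtain ⟨A, hA0, hA⟩ := exists_intervalIntegral_tail_le hGint (mul_pos hε hs)
  -- The extra bandwidth absorbs the floor: `ht t ≥ 1` gives `m ≥ A * ht t`. The far weights are
  -- then compared with the integral of `G` beyond `m / ht t`.
  refine ⟨A + 1, ?_⟩
  filter_upwards [h, hlim.eventually_ge_atTop 1] with t h h1
  have hpos : 0 < ht t := one_pos.trans_le h1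
  have hG0 : ∀ u, 0 ≤ u → 0 ≤ G u := fun u hu => by
    simpa [abs_of_nonneg hu] using (hK.nonneg u).trans (hKG u)
  have hm := Nat.lt_floor_add_one ((A + 1) * ht t)
  have hm' := Nat.floor_le (show 0 ≤ (A + 1) * ht t by positivity)
  set m := ⌊(A + 1) * ht t⌋₊ with hmdef
  simp only [windowWeight]
  rw [← Finset.sum_div]
  refine div_le_of_le_mul₀ (hs.le.trans h) hε.le (le_trans ?_ (mul_le_mul_of_nonneg_left h hε.le))
  set S := (pastWindow t (d t)).filter (fun j : ℕ => (j : ℝ) < t - (A + 1) * ht t) with hS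
  have hmemS : ∀ j ∈ S, 1 ≤ j ∧ j < t ∧ m + 1 ≤ t - j := by
    intro j hj
    rw [hS, Finset.mem_filter] at hj
    obtain ⟨h1, -, h3⟩ := mem_pastWindow (hd t) hj.1
    refine ⟨h1, h3, ?_⟩
    have : (m : ℝ) < (t - j : ℕ) := by rw [Nat.cast_sub h3.le]; linarith [hj.2]
    exact_mod_cast this
  -- Reindexing by lag minus one matches the right-endpoint sum, in which a nonincreasing function
  -- at `i + 1` is bounded by its integral over `[i, i + 1]`.
  have hinj : Set.InjOn (fun j => t - j - 1) (S : Set ℕ) := by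
    intro i hi j hj hij
    have := hmemS i hi
    have := hmemS j hj
    simp only at hij
    omega
  have hanti : AntitoneOn (fun u : ℝ => G (u / ht t)) (Set.Icc (m : ℝ) ((m + t : ℕ) : ℝ)) := by
    intro u hu v hv huv
    have hu0 : 0 ≤ u := (Nat.cast_nonneg m).trans hu.1
    exact hGanti (div_nonneg hu0 hpos.le) (div_nonneg (hu0.trans huv) hpos.le) (by gcongr)
  calc ∑ j ∈ S, scaledKernel K (ht t) ((j : ℝ) - t)
      ≤ ∑ j ∈ S, (ht t)⁻¹ * G (((t - j - 1 + 1 : ℕ) : ℝ) / ht t) := by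
        refine Finset.sum_le_sum fun j hj => ?_
        have hj' := hmemS j hj
        refine mul_le_mul_of_nonneg_left ((hKG _).trans_eq ?_) (inv_nonneg.2 hpos.le)
        rw [show t - j - 1 + 1 = t - j by omega, Nat.cast_sub hj'.2.1.le, abs_div,
          abs_of_pos hpos, abs_sub_comm, abs_of_nonneg]
        exact sub_nonneg.2 (by exact_mod_cast hj'.2.1.le)
    _ = ∑ i ∈ S.image (fun j => t - j - 1), (ht t)⁻¹ * G (((i + 1 : ℕ) : ℝ) / ht t) :=
        (Finset.sum_image
          (f := fun i : ℕ => (ht t)⁻¹ * G (((i + 1 : ℕ) : ℝ) / ht t)) hinj).symm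
    _ ≤ ∑ i ∈ Finset.Ico m (m + t), (ht t)⁻¹ * G (((i + 1 : ℕ) : ℝ) / ht t) := by
        refine Finset.sum_le_sum_of_subset_of_nonneg ?_ fun i _ _ =>
          mul_nonneg (inv_nonneg.2 hpos.le) (hG0 _ (by positivity))
        intro i hi
        obtain ⟨j, hj, rfl⟩ := Finset.mem_image.1 hi
        have := hmemS j hj
        rw [Finset.mem_Ico]
        omega
    _ = (ht t)⁻¹ * ∑ i ∈ Finset.Ico m (m + t), G (((i + 1 : ℕ) : ℝ) / ht t) :=
        (Finset.mul_sum _ _ _).symm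
    _ ≤ (ht t)⁻¹ * ∫ u in (m : ℝ)..((m + t : ℕ) : ℝ), G (u / ht t) :=
        mul_le_mul_of_nonneg_left (hanti.sum_le_integral_Ico (Nat.le_add_right m t))
          (inv_nonneg.2 hpos.le)
    _ = ∫ u in (m : ℝ) / ht t..((m + t : ℕ) : ℝ) / ht t, G u :=
        intervalIntegral.inv_mul_integral_comp_div _
    _ ≤ ε * s := by
        refine hA _ _ ?_ ?_
        · rw [le_div_iff₀ hpos]
          nlinarith
        · gcongr
          exact Nat.le_add_right m t

/-- Weighted averages over the window of a bounded array which is small at recent times tend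
to zero, uniformly in a parameter. -/
theorem eventually_sum_windowWeight_mul_le (hK : IsWindowKernel K) (hd : ∀ t, d t ≤ t)
    (hlim : Tendsto ht atTop atTop) {c : ℝ} (hc : 0 < c) (hcd : ∀ t, 1 ≤ t → c * ht t ≤ d t)
    {ι : Type*} {r : ℕ → ι → ℕ → ℝ} {R : ℝ} (hR : 0 < R)
    (hrR : ∀ t x j, 1 ≤ j → j ≤ t → r t x j ≤ R)
    (hr : ∀ ε > 0, ∃ T : ℕ, ∀ t, T < t → ∀ x (j : ℕ), 1 ≤ j →
      ⌊(t : ℝ) - √(Real.log t) * ht t⌋ ≤ (j : ℤ) → j ≤ t → r t x j ≤ ε)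
    {ε : ℝ} (hε : 0 < ε) :
    ∀ᶠ t in atTop, ∀ x, ∑ j ∈ pastWindow t (d t), windowWeight K ht d t j * r t x j ≤ ε := by
  obtain ⟨A, hA⟩ := exists_sum_windowWeight_far_le hK hd hlim hc hcd
    (show 0 < ε / (2 * R) by positivity)
  obtain ⟨T, hT⟩ := hr (ε / 2) (half_pos hε)
  have hlog : Tendsto (fun t : ℕ => √(Real.log t)) atTop atTop :=
    Real.tendsto_sqrt_atTop.comp (Real.tendsto_log_atTop.comp tendsto_natCast_atTop_atTop)
  filter_upwards [hA, eventually_gt_atTop T, hlog.eventually_ge_atTop A,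
    hlim.eventually_gt_atTop 0, eventually_sum_windowWeight hK hd hlim hc hcd]
    with t hA htT hlogA hpos hsum x
  -- Far times carry weight at most `ε / (2 * R)` against the bound `R`. Near times lie in the
  -- stable range because `A ≤ √(log t)`, and the threshold for `t` does not depend on `x`.
  rw [← Finset.sum_filter_add_sum_filter_not _ (fun j : ℕ => (j : ℝ) < t - A * ht t)]
  have h1 : ∑ j ∈ (pastWindow t (d t)).filter (fun j : ℕ => (j : ℝ) < t - A * ht t),
      windowWeight K ht d t j * r t x j ≤ ε / 2 := by
    calc _ ≤ ∑ j ∈ (pastWindow t (d t)).filter (fun j : ℕ => (j : ℝ) < t - A * ht t),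
        windowWeight K ht d t j * R := by
          refine Finset.sum_le_sum fun j hj => ?_
          have hj' := mem_pastWindow (hd t) (Finset.mem_filter.1 hj).1
          exact mul_le_mul_of_nonneg_left (hrR t x j hj'.1 hj'.2.2.le)
            (windowWeight_nonneg hK hpos j)
      _ ≤ ε / (2 * R) * R := by
          rw [← Finset.sum_mul]
          gcongr
      _ = ε / 2 := by field_simp
  have h2 : ∑ j ∈ (pastWindow t (d t)).filter (fun j : ℕ => ¬ (j : ℝ) < t - A * ht t),
      windowWeight K ht d t j * r t x j ≤ ε / 2 := by
    calc _ ≤ ∑ j ∈ (pastWindow t (d t)).filter (fun j : ℕ => ¬ (j : ℝ) < t - A * ht t),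
        windowWeight K ht d t j * (ε / 2) := by
          refine Finset.sum_le_sum fun j hj => ?_
          obtain ⟨hjw, hj⟩ := Finset.mem_filter.1 hj
          have hj' := mem_pastWindow (hd t) hjw
          refine mul_le_mul_of_nonneg_left (hT t htT x j hj'.1 ?_ hj'.2.2.le)
            (windowWeight_nonneg hK hpos j)
          have h3 : (t : ℝ) - √(Real.log t) * ht t ≤ ((j : ℤ) : ℝ) := by
            push_cast
            have : A * ht t ≤ √(Real.log t) * ht t := by gcongr
            linarith [not_lt.1 hj]
          exact_mod_cast (Int.floor_le _).trans h3
      _ ≤ ∑ j ∈ pastWindow t (d t), windowWeight K ht d t j * (ε / 2) :=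
          Finset.sum_le_sum_of_subset_of_nonneg (Finset.filter_subset _ _) fun j _ _ =>
            mul_nonneg (windowWeight_nonneg hK hpos j) (half_pos hε).le
      _ = ε / 2 := by rw [← Finset.sum_mul, hsum, one_mul]
  linarith

end Weights

/-! ### Independent observations and concentration of weighted means. -/

/-- Independent observations `X 1, X 2, …` with densities `f 1, f 2, …`. -/
structure IsDensityModel {Ω : Type*} [MeasurableSpace Ω] (μ : Measure Ω) (X : ℕ → Ω → ℝ)
    (f : ℕ → ℝ → ℝ) : Prop where
  measurable : ∀ t, 1 ≤ t → Measurable (X t)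
  density : ∀ t, 1 ≤ t → IsDensity (f t)
  law : ∀ t, 1 ≤ t → μ.map (X t) = volume.withDensity (fun x => ENNReal.ofReal (f t x))
  indep : iIndepFun (fun t : ℕ => X (t + 1)) μ

theorem IsTwoGroupModel.isDensity_mixDensity {Ω : Type*} [MeasurableSpace Ω] {μ : Measure Ω}
    {θ : ℕ → Ω → Bool} {X : ℕ → Ω → ℝ} {f₀ : ℝ → ℝ} {f₁ : ℕ → ℝ → ℝ} {π : ℕ → ℝ}
    (h : IsTwoGroupModel μ θ X f₀ f₁ π) {t : ℕ} (ht : 1 ≤ t) :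
    IsDensity (mixDensity f₀ f₁ π t) := by
  have h0 := h.density_null
  have h1 := h.density_alt t ht
  obtain ⟨hp0, hp1⟩ := h.prop_mem t ht
  refine ⟨(h0.measurable.const_mul _).add (h1.measurable.const_mul _), fun x => ?_,
    (h0.integrable.const_mul _).add (h1.integrable.const_mul _), ?_⟩
  · exact add_nonneg (mul_nonneg (sub_nonneg.2 hp1) (h0.nonneg x)) (mul_nonneg hp0 (h1.nonneg x))
  · simp only [mixDensity]
    rw [integral_add (h0.integrable.const_mul _) (h1.integrable.const_mul _),
      integral_const_mul, integral_const_mul, h0.integral_eq_one, h1.integral_eq_one]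
    ring

/-- Summing over the two values of `θ t` leaves the mixture density; the labels play no further
role. -/
theorem IsTwoGroupModel.isDensityModel {Ω : Type*} [MeasurableSpace Ω] {μ : Measure Ω}
    {θ : ℕ → Ω → Bool} {X : ℕ → Ω → ℝ} {f₀ : ℝ → ℝ} {f₁ : ℕ → ℝ → ℝ} {π : ℕ → ℝ}
    (h : IsTwoGroupModel μ θ X f₀ f₁ π) : IsDensityModel μ X (mixDensity f₀ f₁ π) := by
  refine ⟨h.measurable_obs, fun t ht => h.isDensity_mixDensity ht, fun t ht => ?_, h.indep⟩
  obtain ⟨hp0, hp1⟩ := h.prop_mem t ht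
  have h0 := h.density_null
  have h1 := h.density_alt t ht
  ext A hA
  rw [Measure.map_apply (h.measurable_obs t ht) hA, withDensity_apply _ hA]
  have hsplit : X t ⁻¹' A
      = {ω | θ t ω = false ∧ X t ω ∈ A} ∪ {ω | θ t ω = true ∧ X t ω ∈ A} := by
    ext ω
    cases hθ : θ t ω <;> simp [hθ]
  have hmeas : MeasurableSet {ω | θ t ω = true ∧ X t ω ∈ A} :=
    (h.measurable_theta t ht (measurableSet_singleton true)).inter (h.measurable_obs t ht hA)
  have hdisj : Disjoint {ω | θ t ω = false ∧ X t ω ∈ A} {ω | θ t ω = true ∧ X t ω ∈ A} := by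
    rw [Set.disjoint_left]
    rintro ω ⟨ha, -⟩ ⟨hb, -⟩
    simp [ha] at hb
  rw [hsplit, measure_union hdisj hmeas, h.law_null t ht A hA, h.law_alt t ht A hA,
    ← lintegral_const_mul _ h0.measurable.ennreal_ofReal,
    ← lintegral_const_mul _ h1.measurable.ennreal_ofReal,
    ← lintegral_add_left (h0.measurable.ennreal_ofReal.const_mul _)]
  refine lintegral_congr fun x => ?_
  rw [mixDensity, ENNReal.ofReal_add (mul_nonneg (sub_nonneg.2 hp1) (h0.nonneg x))
    (mul_nonneg hp0 (h1.nonneg x)), ENNReal.ofReal_mul (sub_nonneg.2 hp1), ENNReal.ofReal_mul hp0]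

/-- Chebyshev's inequality for a weighted mean of pairwise independent variables. -/
theorem measure_le_abs_weighted_sum_sub_le {Ω : Type*} [MeasurableSpace Ω] {μ : Measure Ω}
    [IsProbabilityMeasure μ] {ι : Type*} {s : Finset ι} {Y : ι → Ω → ℝ} {w : ι → ℝ} {W V m ε : ℝ}
    (hY : ∀ j ∈ s, MemLp (Y j) 2 μ) (hind : (s : Set ι).Pairwise fun i j => IndepFun (Y i) (Y j) μ)
    (hw : ∀ j ∈ s, 0 ≤ w j) (hwW : ∀ j ∈ s, w j ≤ W) (hsum : ∑ j ∈ s, w j = 1)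
    (hV : ∀ j ∈ s, Var[Y j; μ] ≤ V) (hε : 0 < ε)
    (hbias : |∑ j ∈ s, w j * ∫ ω, Y j ω ∂μ - m| ≤ ε / 2) :
    μ {ω | ε ≤ |∑ j ∈ s, w j * Y j ω - m|} ≤ ENNReal.ofReal (4 * (W * V) / ε ^ 2) := by
  have hmem : ∀ j ∈ s, MemLp (fun ω => w j * Y j ω) 2 μ := fun j hj => (hY j hj).const_mul _
  have hmean : ∫ ω, (∑ j ∈ s, fun ω => w j * Y j ω) ω ∂μ = ∑ j ∈ s, w j * ∫ ω, Y j ω ∂μ := by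
    simp only [Finset.sum_apply]
    rw [integral_finsetSum _ fun j hj => (hmem j hj).integrable one_le_two]
    simp only [integral_const_mul]
  have hvar : Var[∑ j ∈ s, fun ω => w j * Y j ω; μ] ≤ W * V := by
    rw [IndepFun.variance_sum hmem fun i hi j hj hij =>
      (hind hi hj hij).comp (measurable_const_mul (w i)) (measurable_const_mul (w j))]
    -- One of the two factors `w j` is bounded by `W`; the other is kept, as the weights sum to one.
    calc ∑ j ∈ s, Var[fun ω => w j * Y j ω; μ] ≤ ∑ j ∈ s, w j * (W * V) := by
          refine Finset.sum_le_sum fun j hj => ?_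
          rw [variance_const_mul, pow_two, mul_assoc]
          refine mul_le_mul_of_nonneg_left ?_ (hw j hj)
          exact mul_le_mul (hwW j hj) (hV j hj) (variance_nonneg _ _)
            ((hw j hj).trans (hwW j hj))
      _ = W * V := by rw [← Finset.sum_mul, hsum, one_mul]
  -- Half of `ε` is reserved for the bias, whence the factor `4` in the bound.
  have hcheb := meas_ge_le_variance_div_sq (memLp_finsetSum' s hmem) (half_pos hε)
  rw [hmean] at hcheb
  refine (measure_mono fun ω hω => ?_).trans (hcheb.trans (ENNReal.ofReal_le_ofReal ?_))
  · simp only [Set.mem_ofPred_eq, Finset.sum_apply] at hω ⊢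
    have := abs_sub_le (∑ j ∈ s, w j * Y j ω) (∑ j ∈ s, w j * ∫ ω, Y j ω ∂μ) m
    linarith
  · rw [div_pow, div_div_eq_mul_div]
    have : Var[∑ j ∈ s, fun ω => w j * Y j ω; μ] * 2 ^ 2 ≤ 4 * (W * V) := by linarith
    gcongr

/-- An event with uniformly small probability in a parameter has small probability when an
independent variable is substituted for the parameter. -/
theorem IndepFun.measure_le_of_forall_le {Ω α β : Type*} [MeasurableSpace Ω] [MeasurableSpace α]
    [MeasurableSpace β] {μ : Measure Ω} [IsProbabilityMeasure μ] {Y : Ω → α} {Z : Ω → β}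
    (hY : Measurable Y) (hZ : Measurable Z) (hind : IndepFun Y Z μ) {S : Set (α × β)}
    (hS : MeasurableSet S) {δ : ENNReal} (hδ : ∀ x, μ {ω | (x, Z ω) ∈ S} ≤ δ) :
    μ {ω | (Y ω, Z ω) ∈ S} ≤ δ := by
  have : IsProbabilityMeasure (μ.map Y) := Measure.isProbabilityMeasure_map hY.aemeasurable
  have h1 : μ {ω | (Y ω, Z ω) ∈ S} = ((μ.map Y).prod (μ.map Z)) S := by
    rw [← (indepFun_iff_map_prod_eq_prod_map_map hY.aemeasurable hZ.aemeasurable).1 hind,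
      Measure.map_apply (hY.prodMk hZ) hS]
    rfl
  rw [h1, Measure.prod_apply hS]
  calc ∫⁻ x, (μ.map Z) (Prod.mk x ⁻¹' S) ∂μ.map Y ≤ ∫⁻ _, δ ∂μ.map Y := by
        refine lintegral_mono fun x => ?_
        rw [Measure.map_apply hZ (measurable_prodMk_left hS)]
        exact hδ x
    _ = δ := by simp

namespace IsDensityModel

variable {Ω : Type*} [MeasurableSpace Ω] {μ : Measure Ω}
  {X : ℕ → Ω → ℝ} {f : ℕ → ℝ → ℝ}

theorem integral_comp (hX : IsDensityModel μ X f) {t : ℕ} (ht : 1 ≤ t) {φ : ℝ → ℝ}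
    (hφ : Measurable φ) : ∫ ω, φ (X t ω) ∂μ = ∫ x, f t x * φ x := by
  rw [← integral_map (hX.measurable t ht).aemeasurable hφ.aestronglyMeasurable, hX.law t ht,
    integral_withDensity_eq_integral_toReal_smul (hX.density t ht).measurable.ennreal_ofReal
      (Eventually.of_forall fun _ => ENNReal.ofReal_lt_top)]
  refine integral_congr_ae (Eventually.of_forall fun x => ?_)
  simp [ENNReal.toReal_ofReal ((hX.density t ht).nonneg x)]

theorem measure_mem (hX : IsDensityModel μ X f) {t : ℕ} (ht : 1 ≤ t) {A : Set ℝ}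
    (hA : MeasurableSet A) : μ {ω | X t ω ∈ A} = ∫⁻ x in A, ENNReal.ofReal (f t x) := by
  rw [← withDensity_apply _ hA, ← hX.law t ht, Measure.map_apply (hX.measurable t ht) hA]
  rfl

theorem indepFun (hX : IsDensityModel μ X f) {i j : ℕ} (hi : 1 ≤ i) (hj : 1 ≤ j) (hij : i ≠ j) :
    IndepFun (X i) (X j) μ := by
  have h := hX.indep.indepFun (show i - 1 ≠ j - 1 by omega)
  rwa [Nat.sub_add_cancel hi, Nat.sub_add_cancel hj] at h

/-- Consistency of a weighted mean of a bounded function of the past observations. -/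
theorem measure_le_abs_weighted_sum_comp_sub_le [IsProbabilityMeasure μ]
    (hX : IsDensityModel μ X f) {s : Finset ℕ}
    (hs : ∀ j ∈ s, 1 ≤ j) {w : ℕ → ℝ} {φ : ℝ → ℝ} (hφ : Measurable φ) {B W V m ε : ℝ}
    (hφ0 : ∀ x, 0 ≤ φ x) (hφB : ∀ x, φ x ≤ B)
    (hw : ∀ j ∈ s, 0 ≤ w j) (hwW : ∀ j ∈ s, w j ≤ W) (hsum : ∑ j ∈ s, w j = 1)
    (hV : ∀ j ∈ s, B * ∫ x, f j x * φ x ≤ V) (hε : 0 < ε)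
    (hbias : ∑ j ∈ s, w j * |(∫ x, f j x * φ x) - m| ≤ ε / 2) :
    μ {ω | ε ≤ |∑ j ∈ s, w j * φ (X j ω) - m|} ≤ ENNReal.ofReal (4 * (W * V) / ε ^ 2) := by
  have hbd : ∀ x, ‖φ x‖ ≤ B := fun x => by rw [Real.norm_of_nonneg (hφ0 x)]; exact hφB x
  have hmeas : ∀ j ∈ s, Measurable fun ω => φ (X j ω) := fun j hj =>
    hφ.comp (hX.measurable j (hs j hj))
  have hmem : ∀ j ∈ s, ∀ q, MemLp (fun ω => φ (X j ω)) q μ := fun j hj q =>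
    MemLp.of_bound (hmeas j hj).aestronglyMeasurable B (Eventually.of_forall fun ω => hbd _)
  refine measure_le_abs_weighted_sum_sub_le (fun j hj => hmem j hj 2) ?_ hw hwW hsum ?_ hε ?_
  · exact fun i hi j hj hij => (hX.indepFun (hs i hi) (hs j hj) hij).comp hφ hφ
  · intro j hj
    -- Only one factor of `φ ^ 2` is replaced by `B`. For a scaled kernel the remaining mean is
    -- bounded, so the variance costs `1 / hx t` and not its square.
    refine (variance_le_expectation_sq (hmeas j hj).aestronglyMeasurable).trans
      (le_trans ?_ (hV j hj))
    rw [← hX.integral_comp (hs j hj) hφ, ← integral_const_mul]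
    refine integral_mono (hmem j hj 2).integrable_sq
      (((hmem j hj 1).integrable le_rfl).const_mul _) fun ω => ?_
    simp only [Pi.pow_apply, pow_two]
    exact mul_le_mul_of_nonneg_right (hφB _) (hφ0 _)
  · refine le_trans ?_ hbias
    have : ∑ j ∈ s, w j * ∫ ω, φ (X j ω) ∂μ - m
        = ∑ j ∈ s, w j * ((∫ x, f j x * φ x) - m) := by
      simp only [mul_sub]
      rw [Finset.sum_sub_distrib, ← Finset.sum_mul, hsum, one_mul]
      congr 1
      exact Finset.sum_congr rfl fun j hj => by rw [hX.integral_comp (hs j hj) hφ]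
    rw [this]
    refine (Finset.abs_sum_le_sum_abs _ _).trans_eq (Finset.sum_congr rfl fun j hj => ?_)
    rw [abs_mul, abs_of_nonneg (hw j hj)]

end IsDensityModel

/-! ### Consistency of the screening estimator. -/

/-- The densities at the recent times are close in `L¹`. -/
def RecentlyStable (f : ℕ → ℝ → ℝ) (ht : ℕ → ℝ) : Prop :=
  ∀ ε > 0, ∃ T : ℕ, ∀ t, T < t → ∀ j : ℕ, 1 ≤ j →
    ⌊(t : ℝ) - √(Real.log t) * ht t⌋ ≤ (j : ℤ) → j ≤ t → ∫ x, |f j x - f t x| < ε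

section Estimators

variable {Ω : Type*} [MeasurableSpace Ω] {μ : Measure Ω} [IsProbabilityMeasure μ]
  {X : ℕ → Ω → ℝ} {f : ℕ → ℝ → ℝ} {K : ℝ → ℝ} {ht hx : ℕ → ℝ} {d : ℕ → ℕ}

theorem one_sub_propEst (p : ℝ → ℝ) (τ : ℝ) (z : ℕ → ℝ) (t : ℕ) :
    1 - propEst K ht d p τ z t = (1 - τ)⁻¹ * ∑ j ∈ pastWindow t (d t),
      windowWeight (fun u => K (-u)) ht d t j * {x | τ < p x}.indicator (fun _ => (1 : ℝ)) (z j) := by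
  have hflip : ∀ i : ℕ, scaledKernel (fun u => K (-u)) (ht t) ((i : ℝ) - t)
      = scaledKernel K (ht t) ((t : ℝ) - i) := fun i => by
    simp only [scaledKernel, ← neg_div, neg_sub]
  simp only [propEst, windowWeight, sub_sub_cancel, hflip]
  rw [Finset.sum_filter, mul_comm (1 - τ), ← div_div, div_eq_inv_mul _ (1 - τ), Finset.sum_div]
  congr 1
  refine Finset.sum_congr rfl fun j _ => ?_
  by_cases h : τ < p (z j)
  · rw [if_pos h, Set.indicator_of_mem (show z j ∈ {x | τ < p x} from h), mul_one]
  · rw [if_neg h, Set.indicator_of_notMem (show z j ∉ {x | τ < p x} from h), mul_zero, zero_div]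

theorem densityEst_eq_sum (z : ℕ → ℝ) (t : ℕ) (x : ℝ) :
    densityEst K ht hx d z t x = ∑ j ∈ pastWindow t (d t),
      windowWeight K ht d t j * scaledKernel K (hx t) (z j - x) := by
  simp only [densityEst, windowWeight]
  rw [Finset.sum_div]
  exact Finset.sum_congr rfl fun j _ => by ring

/-- The screening estimator is consistent. -/
theorem eventually_measure_propEst_sub_le (hX : IsDensityModel μ X f) {p : ℝ → ℝ}
    (hp : Measurable p) {τ : ℝ} (hτ : τ < 1) (hK : IsWindowKernel K) (hd : ∀ t, d t ≤ t)
    (hlim : Tendsto ht atTop atTop) {c : ℝ} (hc : 0 < c) (hcd : ∀ t, 1 ≤ t → c * ht t ≤ d t)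
    (hf : RecentlyStable f ht) {ε δ : ℝ} (hε : 0 < ε) (hδ : 0 < δ) :
    ∀ᶠ t in atTop, μ {ω | ε ≤ |propEst K ht d p τ (fun j => X j ω) t - propTau μ X p τ t|}
      ≤ ENNReal.ofReal δ := by
  have hτ' : 0 < 1 - τ := sub_pos.2 hτ
  have hK' := hK.comp_neg
  set φ : ℝ → ℝ := {x | τ < p x}.indicator (fun _ => (1 : ℝ)) with hφdef
  have hset : MeasurableSet {x | τ < p x} := measurableSet_lt measurable_const hp
  have hφ : Measurable φ := measurable_const.indicator hset
  have hφ0 : ∀ x, 0 ≤ φ x := Set.indicator_nonneg fun _ _ => zero_le_one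
  have hφ1 : ∀ x, φ x ≤ 1 := fun x => Set.indicator_le_self' (fun _ _ => zero_le_one) x
  have hfφ : ∀ j, 1 ≤ j → Integrable fun x => f j x * φ x := fun j hj =>
    (hX.density j hj).integrable.mul_bdd (c := 1) hφ.aestronglyMeasurable
      (Eventually.of_forall fun x => by rw [Real.norm_of_nonneg (hφ0 x)]; exact hφ1 x)
  obtain ⟨D, hD, hDw⟩ := exists_windowWeight_le hK' hd hlim hc hcd
  -- The tolerance for the weighted mean of indicators, which the estimator multiplies by `(1 -
  -- τ)⁻¹`.
  have hη : 0 < (1 - τ) * ε := mul_pos hτ' hε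
  have hmean := eventually_sum_windowWeight_mul_le (ι := Unit) hK' hd hlim hc hcd
    (r := fun t _ j => ∫ x, |f j x - f t x|) (R := 2) two_pos
    (fun t _ j hj hjt => by
      have h1 := hX.density j hj
      have h2 := hX.density t (hj.trans hjt)
      calc ∫ x, |f j x - f t x| ≤ ∫ x, (f j x + f t x) := by
            refine integral_mono (h1.integrable.sub h2.integrable).abs
              (h1.integrable.add h2.integrable) fun x => ?_
            rw [abs_le]
            constructor <;> linarith [h1.nonneg x, h2.nonneg x]
        _ = 2 := by
            rw [integral_add h1.integrable h2.integrable, h1.integral_eq_one, h2.integral_eq_one]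
            norm_num)
    (fun e he => by
      obtain ⟨T, hT⟩ := hf e he
      exact ⟨T, fun t htT _ j h1 h2 h3 => (hT t htT j h1 h2 h3).le⟩) (half_pos hη)
  have hvar : ∀ᶠ t in atTop, 4 * (D / ht t * 1) / ((1 - τ) * ε) ^ 2 ≤ δ := by
    filter_upwards [hlim.eventually_ge_atTop (4 * D / (δ * ((1 - τ) * ε) ^ 2)),
      hlim.eventually_gt_atTop 0] with t h1 h2
    rw [div_le_iff₀ (by positivity)] at h1
    rw [mul_one, mul_div_assoc', div_div, div_le_iff₀ (by positivity)]
    linarith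
  filter_upwards [hDw, hmean, hvar, eventually_sum_windowWeight hK' hd hlim hc hcd,
    hlim.eventually_gt_atTop 0, eventually_ge_atTop 1] with t hDw hmean hvar hsum hpos ht1
  have hwin : ∀ j ∈ pastWindow t (d t), 1 ≤ j := fun j hj => (mem_pastWindow (hd t) hj).1
  have hmt : μ.real {ω | τ < p (X t ω)} = ∫ x, f t x * φ x := by
    rw [← hX.integral_comp ht1 hφ]
    exact (integral_indicator_one (hX.measurable t ht1 hset)).symm
  refine le_trans (measure_mono ?_) ((hX.measure_le_abs_weighted_sum_comp_sub_le hwin hφ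
    (m := ∫ x, f t x * φ x) hφ0 hφ1 (fun j _ => windowWeight_nonneg hK' hpos j)
    (fun j _ => hDw j) hsum (V := 1) ?_ hη ?_).trans (ENNReal.ofReal_le_ofReal hvar))
  · intro ω hω
    simp only [Set.mem_ofPred_eq] at hω ⊢
    have h1 : propEst K ht d p τ (fun j => X j ω) t - propTau μ X p τ t
        = (1 - propTau μ X p τ t) - (1 - propEst K ht d p τ (fun j => X j ω) t) := by ring
    rw [h1, one_sub_propEst, propTau, sub_sub_cancel, ← mul_sub, abs_mul,
      abs_of_pos (inv_pos.2 hτ'), abs_sub_comm, ← div_eq_inv_mul, le_div_iff₀ hτ', hmt] at hω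
    linarith
  · intro j hj
    rw [one_mul, ← (hX.density j (hwin j hj)).integral_eq_one]
    exact integral_mono (hfφ j (hwin j hj)) (hX.density j (hwin j hj)).integrable fun x =>
      mul_le_of_le_one_right ((hX.density j (hwin j hj)).nonneg x) (hφ1 x)
  · refine le_trans (Finset.sum_le_sum fun j hj => ?_) (hmean ())
    refine mul_le_mul_of_nonneg_left ?_ (windowWeight_nonneg hK' hpos j)
    have h1 := hX.density j (hwin j hj)
    have h2 := hX.density t ht1
    rw [← integral_sub (hfφ j (hwin j hj)) (hfφ t ht1)]
    refine abs_integral_le_integral_abs.trans (integral_mono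
      ((hfφ j (hwin j hj)).sub (hfφ t ht1)).abs (h1.integrable.sub h2.integrable).abs fun x => ?_)
    simp only [← sub_mul, abs_mul, abs_of_nonneg (hφ0 x)]
    exact mul_le_of_le_one_right (abs_nonneg _) (hφ1 x)

end Estimators

/-! ### Kernel smoothing and consistency of the density estimator. -/

theorem measurable_scaledKernel {K : ℝ → ℝ} (hK : Measurable K) (h : ℝ) :
    Measurable (scaledKernel K h) :=
  (hK.comp (measurable_id.div_const h)).const_mul _

theorem IsKernel.integrable_scaledKernel {K : ℝ → ℝ} (hK : IsKernel K) {h : ℝ} (hh : 0 < h) :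
    Integrable (scaledKernel K h) :=
  (hK.density.integrable.comp_div hh.ne').const_mul _

theorem IsKernel.integral_scaledKernel {K : ℝ → ℝ} (hK : IsKernel K) {h : ℝ} (hh : 0 < h) :
    ∫ u, scaledKernel K h u = 1 := by
  simp only [scaledKernel]
  rw [integral_const_mul, Measure.integral_comp_div, hK.density.integral_eq_one, abs_of_pos hh]
  simp [hh.ne']

theorem abs_mul_scaledKernel (K : ℝ → ℝ) {h : ℝ} (hh : 0 < h) (u : ℝ) :
    |u| * scaledKernel K h u = |u / h| * K (u / h) := by
  rw [scaledKernel, abs_div, abs_of_pos hh]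
  ring

theorem IsKernel.integrable_abs_mul {K : ℝ → ℝ} (hK : IsKernel K) :
    Integrable fun u => |u| * K u := by
  refine hK.integrable_mul.abs.congr (Eventually.of_forall fun u => ?_)
  simp only [abs_mul, abs_of_nonneg (hK.density.nonneg u)]

theorem IsKernel.integrable_abs_mul_scaledKernel {K : ℝ → ℝ} (hK : IsKernel K) {h : ℝ}
    (hh : 0 < h) : Integrable fun u => |u| * scaledKernel K h u := by
  simp only [abs_mul_scaledKernel K hh]
  exact hK.integrable_abs_mul.comp_div hh.ne'

theorem integral_abs_mul_scaledKernel (K : ℝ → ℝ) {h : ℝ} (hh : 0 < h) : ∫ u, |u| * scaledKernel K h u = h * ∫ u, |u| * K u := by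
  simp only [abs_mul_scaledKernel K hh]
  rw [Measure.integral_comp_div (fun u => |u| * K u), abs_of_pos hh, smul_eq_mul]

/-- The bias of kernel smoothing for a Lipschitz function. -/
theorem IsKernel.abs_integral_mul_scaledKernel_sub_le {K : ℝ → ℝ} (hK : IsKernel K) {h : ℝ}
    (hh : 0 < h) {g : ℝ → ℝ} {L : ℝ} (hg : ∀ x y, |g x - g y| ≤ L * |x - y|) {x : ℝ}
    (hgint : Integrable fun y => g y * scaledKernel K h (y - x)) (v : ℝ) :
    |(∫ y, g y * scaledKernel K h (y - x)) - v|
      ≤ L * (h * ∫ u, |u| * K u) + |g x - v| := by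
  have hnn : ∀ u, 0 ≤ scaledKernel K h u := hK.isWindowKernel.scaledKernel_nonneg hh
  have i0 : Integrable fun y => scaledKernel K h (y - x) :=
    (hK.integrable_scaledKernel hh).comp_sub_right x
  have i1 : Integrable fun y => |y - x| * scaledKernel K h (y - x) :=
    (hK.integrable_abs_mul_scaledKernel hh).comp_sub_right x
  have e0 : ∫ y, scaledKernel K h (y - x) = 1 :=
    (integral_sub_right_eq_self (scaledKernel K h) x).trans (hK.integral_scaledKernel hh)
  have e1 : ∫ y, |y - x| * scaledKernel K h (y - x) = h * ∫ u, |u| * K u :=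
    (integral_sub_right_eq_self (fun u => |u| * scaledKernel K h u) x).trans
      (_root_.integral_abs_mul_scaledKernel K hh)
  have hsub : (∫ y, g y * scaledKernel K h (y - x)) - v
      = ∫ y, (g y * scaledKernel K h (y - x) - v * scaledKernel K h (y - x)) := by
    rw [integral_sub hgint (i0.const_mul v), integral_const_mul, e0, mul_one]
  rw [hsub]
  calc _ ≤ ∫ y, |g y * scaledKernel K h (y - x) - v * scaledKernel K h (y - x)| :=
        abs_integral_le_integral_abs
    _ ≤ ∫ y, (L * (|y - x| * scaledKernel K h (y - x))
          + |g x - v| * scaledKernel K h (y - x)) := by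
        refine integral_mono (hgint.sub (i0.const_mul v)).abs
          ((i1.const_mul L).add (i0.const_mul _)) fun y => ?_
        simp only [← sub_mul, abs_mul, abs_of_nonneg (hnn _), ← mul_assoc, ← add_mul]
        refine mul_le_mul_of_nonneg_right ?_ (hnn _)
        exact (abs_sub_le (g y) (g x) v).trans (add_le_add_left (hg y x) _)
    _ = L * (h * ∫ u, |u| * K u) + |g x - v| := by
        rw [integral_add (i1.const_mul L) (i0.const_mul _), integral_const_mul,
          integral_const_mul, e0, e1, mul_one]

section Estimators

variable {Ω : Type*} [MeasurableSpace Ω] {μ : Measure Ω} [IsProbabilityMeasure μ]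
  {X : ℕ → Ω → ℝ} {f : ℕ → ℝ → ℝ} {K : ℝ → ℝ} {ht hx : ℕ → ℝ} {d : ℕ → ℕ}

/-- The density estimator is consistent, uniformly in the point. -/
theorem eventually_measure_densityEst_sub_le (hX : IsDensityModel μ X f) (hK : IsKernel K)
    (hd : ∀ t, d t ≤ t) (hhx : ∀ t, 1 ≤ t → 0 < hx t) (hx0 : Tendsto hx atTop (𝓝 0))
    (hlim : Tendsto ht atTop atTop) (hprod : Tendsto (fun t => hx t * ht t) atTop atTop)
    {c : ℝ} (hc : 0 < c) (hcd : ∀ t, 1 ≤ t → c * ht t ≤ d t) (hf : RecentlyStable f ht)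
    {C L : ℝ} (hC0 : 0 < C) (hL0 : 0 < L) (hC : ∀ j, 1 ≤ j → ∀ x, f j x ≤ C)
    (hL : ∀ j, 1 ≤ j → ∀ x y, |f j x - f j y| ≤ L * |x - y|)
    {ε δ : ℝ} (hε : 0 < ε) (hδ : 0 < δ) :
    ∀ᶠ t in atTop, ∀ x, μ {ω | ε ≤ |densityEst K ht hx d (fun j => X j ω) t x - f t x|}
      ≤ ENNReal.ofReal δ := by
  have hWK := hK.isWindowKernel
  obtain ⟨D, hD, hDw⟩ := exists_windowWeight_le hWK hd hlim hc hcd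
  obtain ⟨B, hB, hKB⟩ := hWK.exists_bound
  have hmean := eventually_sum_windowWeight_mul_le (ι := ℝ) hWK hd hlim hc hcd
    (r := fun t x j => |f j x - f t x|) (R := C) hC0
    (fun t x j hj hjt => by
      have h1 := hX.density j hj
      have h2 := hX.density t (hj.trans hjt)
      rw [abs_le]
      constructor <;> linarith [h1.nonneg x, h2.nonneg x, hC j hj x, hC t (hj.trans hjt) x])
    (fun e he => by
      -- The difference of two densities is `2 * L`-Lipschitz, so this L¹ bound forces it below `e`
      -- at every point.
      obtain ⟨T, hT⟩ := hf (e ^ 2 / (4 * (2 * L))) (by positivity)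
      refine ⟨T, fun t htT x j h1 h2 h3 => (abs_lt_of_integral_abs_lt (L := 2 * L)
        (g := fun y => f j y - f t y) (by positivity) he ?_ ?_ (hT t htT j h1 h2 h3) x).le⟩
      · intro a b
        have e1 := hL j h1 a b
        have e2 := hL t (h1.trans h3) a b
        have e3 := abs_sub (f j a - f j b) (f t a - f t b)
        have e4 : f j a - f t a - (f j b - f t b) = f j a - f j b - (f t a - f t b) := by ring
        simp only [e4]
        linarith
      · exact (hX.density j h1).integrable.sub (hX.density t (h1.trans h3)).integrable)
    (show 0 < ε / 4 by positivity)
  have hbias : ∀ᶠ t in atTop, L * (hx t * ∫ u, |u| * K u) ≤ ε / 4 := by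
    have h1 : Tendsto (fun t => L * (hx t * ∫ u, |u| * K u)) atTop (𝓝 0) := by
      simpa using (hx0.mul_const (∫ u, |u| * K u)).const_mul L
    exact h1.eventually_le_const (by positivity)
  have hvar : ∀ᶠ t in atTop, 4 * (D / ht t * (B / hx t * C)) / ε ^ 2 ≤ δ := by
    filter_upwards [hprod.eventually_ge_atTop (4 * D * B * C / (δ * ε ^ 2)),
      hlim.eventually_gt_atTop 0, eventually_ge_atTop 1] with t h1 h2 h3
    have h4 := hhx t h3
    rw [div_le_iff₀ (by positivity)] at h1
    have : 4 * (D / ht t * (B / hx t * C)) = 4 * D * B * C / (hx t * ht t) := by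
      field_simp
    rw [this, div_div, div_le_iff₀ (by positivity)]
    linarith
  filter_upwards [hDw, hmean, hbias, hvar, eventually_sum_windowWeight hWK hd hlim hc hcd,
    hlim.eventually_gt_atTop 0, eventually_ge_atTop 1]
    with t hDw hmean hbias hvar hsum hpos ht1 x
  have hx1 := hhx t ht1
  have hwin : ∀ j ∈ pastWindow t (d t), 1 ≤ j := fun j hj => (mem_pastWindow (hd t) hj).1
  have hφ : Measurable fun y => scaledKernel K (hx t) (y - x) :=
    (measurable_scaledKernel hK.density.measurable _).comp (measurable_id.sub_const x)
  have hφ0 : ∀ y, 0 ≤ scaledKernel K (hx t) (y - x) := fun y => hWK.scaledKernel_nonneg hx1 _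
  have hφB : ∀ y, scaledKernel K (hx t) (y - x) ≤ B / hx t := fun y => by
    rw [div_eq_inv_mul]
    exact mul_le_mul_of_nonneg_left (hKB _) (inv_nonneg.2 hx1.le)
  have hφi : Integrable fun y => scaledKernel K (hx t) (y - x) :=
    (hK.integrable_scaledKernel hx1).comp_sub_right x
  have hfφ : ∀ j, 1 ≤ j → Integrable fun y => f j y * scaledKernel K (hx t) (y - x) :=
    fun j hj => (hX.density j hj).integrable.mul_bdd (c := B / hx t) hφ.aestronglyMeasurable
      (Eventually.of_forall fun y => by rw [Real.norm_of_nonneg (hφ0 y)]; exact hφB y)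
  simp only [densityEst_eq_sum]
  refine (hX.measure_le_abs_weighted_sum_comp_sub_le hwin hφ hφ0 hφB
    (fun j _ => windowWeight_nonneg hWK hpos j) (fun j _ => hDw j) hsum (V := B / hx t * C)
    ?_ hε ?_).trans (ENNReal.ofReal_le_ofReal hvar)
  · intro j hj
    refine mul_le_mul_of_nonneg_left ?_ (by positivity)
    calc ∫ y, f j y * scaledKernel K (hx t) (y - x)
        ≤ ∫ y, C * scaledKernel K (hx t) (y - x) :=
          integral_mono (hfφ j (hwin j hj)) (hφi.const_mul C) fun y =>
            mul_le_mul_of_nonneg_right (hC j (hwin j hj) y) (hφ0 y)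
      _ = C := by
          rw [integral_const_mul, integral_sub_right_eq_self (scaledKernel K (hx t)) x,
            hK.integral_scaledKernel hx1, mul_one]
  · calc _ ≤ ∑ j ∈ pastWindow t (d t), (windowWeight K ht d t j * (ε / 4)
          + windowWeight K ht d t j * |f j x - f t x|) := by
          refine Finset.sum_le_sum fun j hj => ?_
          rw [← mul_add]
          refine mul_le_mul_of_nonneg_left ?_ (windowWeight_nonneg hWK hpos j)
          exact (hK.abs_integral_mul_scaledKernel_sub_le hx1 (hL j (hwin j hj))
            (hfφ j (hwin j hj)) _).trans (add_le_add_left hbias _)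
      _ ≤ ε / 2 := by
          rw [Finset.sum_add_distrib, ← Finset.sum_mul, hsum, one_mul]
          linarith [hmean x]

/-- The density estimator is consistent at the current observation. -/
theorem eventually_measure_densityEst_obs_sub_le (hX : IsDensityModel μ X f) (hK : IsKernel K)
    (hd : ∀ t, d t ≤ t) (hhx : ∀ t, 1 ≤ t → 0 < hx t) (hx0 : Tendsto hx atTop (𝓝 0))
    (hlim : Tendsto ht atTop atTop) (hprod : Tendsto (fun t => hx t * ht t) atTop atTop)
    {c : ℝ} (hc : 0 < c) (hcd : ∀ t, 1 ≤ t → c * ht t ≤ d t) (hf : RecentlyStable f ht)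
    {C L : ℝ} (hC0 : 0 < C) (hL0 : 0 < L) (hC : ∀ j, 1 ≤ j → ∀ x, f j x ≤ C)
    (hL : ∀ j, 1 ≤ j → ∀ x y, |f j x - f j y| ≤ L * |x - y|)
    {ε δ : ℝ} (hε : 0 < ε) (hδ : 0 < δ) :
    ∀ᶠ t in atTop,
      μ {ω | ε ≤ |densityEst K ht hx d (fun j => X j ω) t (X t ω) - f t (X t ω)|}
        ≤ ENNReal.ofReal δ := by
  filter_upwards [eventually_measure_densityEst_sub_le hX hK hd hhx hx0 hlim hprod hc hcd hf
    hC0 hL0 hC hL hε hδ, eventually_ge_atTop 1] with t h ht1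
  -- The past `X 1, …, X (t - 1)`, with indices shifted by one as in the independent family.
  set Z : Ω → Finset.range (t - 1) → ℝ := fun ω i => X (i + 1) ω with hZdef
  have hZ : Measurable Z := measurable_pi_lambda _ fun i => hX.measurable _ (by omega)
  have hind : IndepFun (X t) Z μ := by
    have h1 := hX.indep.indepFun_finset {t - 1} (Finset.range (t - 1)) (by simp)
      fun i => hX.measurable _ (by omega)
    have h2 : Measurable fun z : ({t - 1} : Finset ℕ) → ℝ => z ⟨t - 1, by simp⟩ :=
      measurable_pi_apply _
    have h3 := h1.comp h2 measurable_id
    simpa only [Function.comp_def, Nat.sub_add_cancel ht1, id] using h3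
  -- Extends a past to a full sequence. The estimator reads only window times, so the default value
  -- `0` is never seen.
  set e : (Finset.range (t - 1) → ℝ) → ℕ → ℝ := fun z j =>
    if hj : j - 1 ∈ Finset.range (t - 1) then z ⟨j - 1, hj⟩ else 0 with hedef
  have he : ∀ j, Measurable fun z => e z j := by
    intro j
    by_cases hj : j - 1 ∈ Finset.range (t - 1)
    · simp only [hedef, dif_pos hj]
      exact measurable_pi_apply _
    · simp only [hedef, dif_neg hj]
      exact measurable_const
  have heZ : ∀ ω x, densityEst K ht hx d (e (Z ω)) t x
      = densityEst K ht hx d (fun j => X j ω) t x := by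
    intro ω x
    simp only [densityEst_eq_sum]
    refine Finset.sum_congr rfl fun j hj => ?_
    obtain ⟨h1, h2, h3⟩ := mem_pastWindow (hd t) hj
    have hj' : j - 1 ∈ Finset.range (t - 1) := Finset.mem_range.2 (by omega)
    simp only [hedef, dif_pos hj', hZdef, Nat.sub_add_cancel h1]
  have hS : MeasurableSet {q : ℝ × (Finset.range (t - 1) → ℝ) |
      ε ≤ |densityEst K ht hx d (e q.2) t q.1 - f t q.1|} := by
    have h1 : Measurable fun q : ℝ × (Finset.range (t - 1) → ℝ) =>
        densityEst K ht hx d (e q.2) t q.1 := by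
      simp only [densityEst_eq_sum]
      exact Finset.measurable_sum _ fun j _ =>
        ((measurable_scaledKernel hK.density.measurable _).comp
          (((he j).comp measurable_snd).sub measurable_fst)).const_mul _
    exact measurableSet_le measurable_const
      (measurable_norm.comp (h1.sub ((hX.density t ht1).measurable.comp measurable_fst)))
  have := IndepFun.measure_le_of_forall_le (hX.measurable t ht1) hZ hind hS
    (δ := ENNReal.ofReal δ) fun x => by simpa only [Set.mem_ofPred_eq, heZ] using h x
  simpa only [Set.mem_ofPred_eq, heZ] using this

end Estimators

/-! ### Densities evaluated at the current observation. -/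

section Observation

variable {Ω : Type*} [MeasurableSpace Ω] {μ : Measure Ω} {X : ℕ → Ω → ℝ} {f : ℕ → ℝ → ℝ}

/-- Under tightness, the density at the observation is bounded away from zero in probability. -/
theorem IsDensityModel.exists_measure_lt_le (hX : IsDensityModel μ X f)
    (hTight : ∀ ε > 0, ∃ M : ℝ, ∀ t, 1 ≤ t → ∫ x in {x : ℝ | M < |x|}, f t x < ε)
    {δ : ℝ} (hδ : 0 < δ) :
    ∃ η > 0, ∀ t, 1 ≤ t → μ {ω | f t (X t ω) < η} ≤ ENNReal.ofReal δ := by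
  obtain ⟨M, hM⟩ := hTight (δ / 2) (half_pos hδ)
  -- On `[-M, M]`, the region where `f t < η` has mass at most `2 * |M| * η`, hence at most `δ / 2`;
  -- the `+ 1` keeps the denominator positive.
  refine ⟨δ / 2 / (2 * |M| + 1), by positivity, fun t ht => ?_⟩
  set η := δ / 2 / (2 * |M| + 1) with hη
  have hη0 : 0 < η := by positivity
  have hd := hX.density t ht
  have hA : MeasurableSet {x | f t x < η} := measurableSet_lt hd.measurable measurable_const
  have hcover : {x | f t x < η} ⊆ {x | M < |x|} ∪ ({x | f t x < η} ∩ Set.Icc (-M) M) := by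
    intro x hx
    by_cases h : M < |x|
    · exact Or.inl h
    · exact Or.inr ⟨hx, abs_le.1 (not_lt.1 h)⟩
  have h1 : ∫⁻ x in {x | M < |x|}, ENNReal.ofReal (f t x) ≤ ENNReal.ofReal (δ / 2) := by
    rw [← ofReal_integral_eq_lintegral_ofReal hd.integrable.integrableOn
      (Eventually.of_forall hd.nonneg)]
    exact ENNReal.ofReal_le_ofReal (hM t ht).le
  have h2 : ∫⁻ x in {x | f t x < η} ∩ Set.Icc (-M) M, ENNReal.ofReal (f t x)
      ≤ ENNReal.ofReal (δ / 2) := by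
    calc _ ≤ ∫⁻ _ in {x | f t x < η} ∩ Set.Icc (-M) M, ENNReal.ofReal η :=
          setLIntegral_mono measurable_const fun x hx => ENNReal.ofReal_le_ofReal (le_of_lt hx.1)
      _ ≤ ENNReal.ofReal η * volume (Set.Icc (-M) M) := by
          rw [setLIntegral_const]
          gcongr
          exact Set.inter_subset_right
      _ ≤ ENNReal.ofReal (δ / 2) := by
          rw [Real.volume_Icc, ← ENNReal.ofReal_mul hη0.le]
          refine ENNReal.ofReal_le_ofReal ?_
          calc η * (M - -M) ≤ η * (2 * |M| + 1) := by
                gcongr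
                linarith [le_abs_self M]
            _ = δ / 2 := div_mul_cancel₀ _ (by positivity)
  calc μ {ω | f t (X t ω) < η} = ∫⁻ x in {x | f t x < η}, ENNReal.ofReal (f t x) :=
        hX.measure_mem ht hA
    _ ≤ _ := (lintegral_mono_set hcover).trans (lintegral_union_le _ _ _)
    _ ≤ ENNReal.ofReal (δ / 2) + ENNReal.ofReal (δ / 2) := add_le_add h1 h2
    _ = ENNReal.ofReal δ := by
        rw [← ENNReal.ofReal_add (half_pos hδ).le (half_pos hδ).le, add_halves]

/-- The likelihood ratio `g / f` at an observation with density `f` is stochastically bounded. -/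
theorem IsDensityModel.measure_mul_lt_le (hX : IsDensityModel μ X f) {g : ℝ → ℝ}
    (hg : IsDensity g) {M : ℝ} (hM : 0 < M) {t : ℕ} (ht : 1 ≤ t) :
    μ {ω | M * f t (X t ω) < g (X t ω)} ≤ ENNReal.ofReal M⁻¹ := by
  have hd := hX.density t ht
  have hA : MeasurableSet {x | M * f t x < g x} :=
    measurableSet_lt (hd.measurable.const_mul M) hg.measurable
  calc μ {ω | M * f t (X t ω) < g (X t ω)}
      = ∫⁻ x in {x | M * f t x < g x}, ENNReal.ofReal (f t x) := hX.measure_mem ht hA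
    _ ≤ ∫⁻ x in {x | M * f t x < g x}, ENNReal.ofReal (M⁻¹ * g x) := by
        refine setLIntegral_mono (hg.measurable.const_mul _).ennreal_ofReal fun x hx =>
          ENNReal.ofReal_le_ofReal ?_
        rw [← div_eq_inv_mul, le_div_iff₀ hM, mul_comm]
        exact le_of_lt hx
    _ ≤ ∫⁻ x, ENNReal.ofReal (M⁻¹ * g x) := setLIntegral_le_lintegral _ _
    _ = ENNReal.ofReal M⁻¹ := by
        rw [← ofReal_integral_eq_lintegral_ofReal (hg.integrable.const_mul _)
          (Eventually.of_forall fun x => mul_nonneg (inv_nonneg.2 hM.le) (hg.nonneg x)),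
          integral_const_mul, hg.integral_eq_one, mul_one]

end Observation

/-! ### The plug-in ratio and its truncation. -/

/-- Stability of the ratio `n * a / b` under perturbation of `n` and `b`. -/
theorem abs_mul_div_sub_mul_div_le {a b b' n n' η M Q e₁ e₂ : ℝ} (hη : 0 < η) (hb : η ≤ b)
    (ha : 0 ≤ a) (haM : a ≤ M * b) (hM : 0 ≤ M) (hn : 0 ≤ n) (hnQ : n ≤ Q)
    (h₁ : |b' - b| ≤ e₁) (he₁ : e₁ ≤ η / 2) (h₂ : |n' - n| ≤ e₂) :
    |n' * a / b' - n * a / b| ≤ M * (2 * e₂ + 2 * Q * e₁ / η) := by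
  have hb0 : 0 < b := hη.trans_le hb
  have hb' : b / 2 ≤ b' := by linarith [(abs_le.1 h₁).1]
  have hb'0 : 0 < b' := by linarith
  have he₂ : 0 ≤ e₂ := (abs_nonneg _).trans h₂
  have he₁0 : 0 ≤ e₁ := (abs_nonneg _).trans h₁
  have hQ : 0 ≤ Q := hn.trans hnQ
  have key : n' * a / b' - n * a / b = (a / b) * ((n' - n) * (b / b') - n * ((b' - b) / b')) := by
    field_simp
    ring
  have hr : b / b' ≤ 2 := by rw [div_le_iff₀ hb'0]; linarith
  have hr0 : 0 ≤ b / b' := by positivity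
  have h3 : |(b' - b) / b'| ≤ 2 * e₁ / η := by
    rw [abs_div, abs_of_pos hb'0, show 2 * e₁ / η = e₁ / (η / 2) by field_simp]
    exact div_le_div₀ he₁0 h₁ (half_pos hη) (by linarith)
  rw [key, abs_mul, abs_of_nonneg (div_nonneg ha hb0.le)]
  refine mul_le_mul ((div_le_iff₀ hb0).2 haM) ?_ (abs_nonneg _) hM
  refine (abs_sub _ _).trans ?_
  rw [abs_mul, abs_mul, abs_of_nonneg hr0, abs_of_nonneg hn]
  calc |n' - n| * (b / b') + n * |(b' - b) / b'| ≤ e₂ * 2 + Q * (2 * e₁ / η) := by gcongr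
    _ = 2 * e₂ + 2 * Q * e₁ / η := by ring

theorem tendstoInMeasure_zero_of_forall_eventually {Ω : Type*} [MeasurableSpace Ω] {μ : Measure Ω}
    {g : ℕ → Ω → ℝ} (h : ∀ ε δ : ℝ, 0 < ε → 0 < δ →
      ∀ᶠ t in atTop, μ {ω | ε ≤ |g t ω|} ≤ ENNReal.ofReal δ) :
    TendstoInMeasure μ g atTop (fun _ => 0) := by
  rw [tendstoInMeasure_iff_norm]
  intro ε hε
  rw [ENNReal.tendsto_nhds_zero]
  intro δ hδ
  rcases eq_or_ne δ ⊤ with rfl | hδ'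
  · exact Eventually.of_forall fun _ => le_top
  · filter_upwards [h ε δ.toReal hε (ENNReal.toReal_pos hδ.ne' hδ')] with t ht
    simpa only [sub_zero, Real.norm_eq_abs, ENNReal.ofReal_toReal hδ'] using ht

/-- The plug-in ratio estimator is consistent. -/
theorem tendstoInMeasure_clfdrRatioEst_sub {Ω : Type*} [MeasurableSpace Ω] {μ : Measure Ω}
    [IsProbabilityMeasure μ] {X : ℕ → Ω → ℝ} {f₀ : ℝ → ℝ} {f₁ : ℕ → ℝ → ℝ} {π : ℕ → ℝ}
    (hX : IsDensityModel μ X (mixDensity f₀ f₁ π)) (hf₀ : IsDensity f₀)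
    {p : ℝ → ℝ} (hp : Measurable p) {τ : ℝ} (hτ : τ < 1) {K : ℝ → ℝ} (hK : IsKernel K)
    {ht hx : ℕ → ℝ} {d : ℕ → ℕ} (hd : ∀ t, d t ≤ t) (hhx : ∀ t, 1 ≤ t → 0 < hx t)
    (hTight : ∀ ε > 0, ∃ M : ℝ, ∀ t, 1 ≤ t →
      ∫ x in {x : ℝ | M < |x|}, mixDensity f₀ f₁ π t x < ε)
    (hx0 : Tendsto hx atTop (𝓝 0)) (hlim : Tendsto ht atTop atTop)
    (hprod : Tendsto (fun t => hx t * ht t) atTop atTop)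
    {c : ℝ} (hc : 0 < c) (hcd : ∀ t, 1 ≤ t → c * ht t ≤ d t)
    (hf : RecentlyStable (mixDensity f₀ f₁ π) ht)
    {C L : ℝ} (hC0 : 0 < C) (hL0 : 0 < L) (hC : ∀ j, 1 ≤ j → ∀ x, mixDensity f₀ f₁ π j x ≤ C)
    (hL : ∀ j, 1 ≤ j → ∀ x y,
      |mixDensity f₀ f₁ π j x - mixDensity f₀ f₁ π j y| ≤ L * |x - y|) :
    TendstoInMeasure μ
      (fun (t : ℕ) ω => clfdrRatioEst f₀ K ht hx d p τ (fun j => X j ω) t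
        - clfdrTau μ X f₀ f₁ π p τ t ω) atTop (fun _ => 0) := by
  refine tendstoInMeasure_zero_of_forall_eventually fun ε δ hε hδ => ?_
  have hτ' : 0 < 1 - τ := sub_pos.2 hτ
  have hδ4 : 0 < δ / 4 := by positivity
  obtain ⟨η, hη, hlow⟩ := hX.exists_measure_lt_le hTight hδ4
  set M : ℝ := (δ / 4)⁻¹ with hMdef
  have hM : 0 < M := inv_pos.2 hδ4
  set Q : ℝ := (1 - τ)⁻¹ with hQdef
  have hQ : 0 < Q := inv_pos.2 hτ'
  -- The term `η / 2` keeps the estimated density above half the true one. The other choices make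
  -- each of the two errors contribute at most `ε / 4`.
  set e₁ : ℝ := min (η / 2) (ε * η / (8 * M * Q)) with he₁def
  have he₁ : 0 < e₁ := by positivity
  set e₂ : ℝ := ε / (8 * M) with he₂def
  have he₂ : 0 < e₂ := by positivity
  have hsmall : M * (2 * e₂ + 2 * Q * e₁ / η) ≤ ε / 2 := by
    have h1 : 2 * Q * e₁ / η ≤ 2 * Q * (ε * η / (8 * M * Q)) / η := by
      gcongr
      exact min_le_right _ _
    calc M * (2 * e₂ + 2 * Q * e₁ / η)
        ≤ M * (2 * (ε / (8 * M)) + 2 * Q * (ε * η / (8 * M * Q)) / η) := by gcongr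
      _ = ε / 2 := by field_simp; ring
  filter_upwards [eventually_measure_densityEst_obs_sub_le hX hK hd hhx hx0 hlim hprod hc hcd hf
      hC0 hL0 hC hL he₁ hδ4,
    eventually_measure_propEst_sub_le hX hp hτ hK.isWindowKernel hd hlim hc hcd hf he₂ hδ4,
    eventually_ge_atTop 1] with t hdens hprop ht1
  have hratio := hX.measure_mul_lt_le hf₀ hM ht1
  rw [hMdef, inv_inv] at hratio
  have hN : 1 - propTau μ X p τ t = Q * μ.real {ω | τ < p (X t ω)} := by
    rw [propTau, sub_sub_cancel]
  have hN0 : 0 ≤ 1 - propTau μ X p τ t := by rw [hN]; positivity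
  have hNQ : 1 - propTau μ X p τ t ≤ Q := by
    rw [hN]
    exact mul_le_of_le_one_right hQ.le measureReal_le_one
  have hcover : {ω | ε ≤ |clfdrRatioEst f₀ K ht hx d p τ (fun j => X j ω) t
      - clfdrTau μ X f₀ f₁ π p τ t ω|} ⊆
      (({ω | mixDensity f₀ f₁ π t (X t ω) < η}
        ∪ {ω | M * mixDensity f₀ f₁ π t (X t ω) < f₀ (X t ω)})
      ∪ {ω | e₁ ≤ |densityEst K ht hx d (fun j => X j ω) t (X t ω)
          - mixDensity f₀ f₁ π t (X t ω)|})
      ∪ {ω | e₂ ≤ |propEst K ht d p τ (fun j => X j ω) t - propTau μ X p τ t|} := by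
    intro ω hω
    by_contra hcon
    simp only [Set.mem_union, Set.mem_ofPred_eq, not_or, not_lt, not_le] at hcon
    obtain ⟨⟨⟨h1, h2⟩, h3⟩, h4⟩ := hcon
    have := abs_mul_div_sub_mul_div_le (n' := 1 - propEst K ht d p τ (fun j => X j ω) t)
      (n := 1 - propTau μ X p τ t) hη h1 (hf₀.nonneg _) h2 hM.le hN0 hNQ h3.le
      (min_le_left _ _) (e₂ := e₂)
      (by rw [sub_sub_sub_cancel_left, abs_sub_comm]; exact h4.le)
    simp only [Set.mem_ofPred_eq, clfdrRatioEst, clfdrTau] at hω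
    linarith
  refine (measure_mono hcover).trans ?_
  calc _ ≤ ENNReal.ofReal (δ / 4) + ENNReal.ofReal (δ / 4) + ENNReal.ofReal (δ / 4)
        + ENNReal.ofReal (δ / 4) := by
        refine (measure_union_le _ _).trans (add_le_add ?_ hprop)
        refine (measure_union_le _ _).trans (add_le_add ?_ hdens)
        exact (measure_union_le _ _).trans (add_le_add (hlow t ht1) hratio)
    _ = ENNReal.ofReal δ := by
        rw [← ENNReal.ofReal_add, ← ENNReal.ofReal_add, ← ENNReal.ofReal_add]
        · congr 1; ring
        all_goals positivity

theorem mainTheorem7 {Ω : Type*} [MeasurableSpace Ω] (μ : Measure Ω) [IsProbabilityMeasure μ]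
    (θ : ℕ → Ω → Bool) (X : ℕ → Ω → ℝ) (f₀ : ℝ → ℝ) (f₁ : ℕ → ℝ → ℝ) (π : ℕ → ℝ)
    (hmodel : IsTwoGroupModel μ θ X f₀ f₁ π)
    (p : ℝ → ℝ) (hp : IsPValue f₀ p) (τ : ℝ) (hτ₀ : 0 ≤ τ) (hτ₁ : τ < 1)
    (K : ℝ → ℝ) (hK : IsKernel K)
    (ht hx : ℕ → ℝ) (hht : ∀ t, 1 ≤ t → 0 < ht t) (hhx : ∀ t, 1 ≤ t → 0 < hx t)
    (d : ℕ → ℕ) (hd : ∀ t, d t ≤ t)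
    (hTight : ∀ ε > 0, ∃ M : ℝ, ∀ t, 1 ≤ t →
      ∫ x in {x : ℝ | M < |x|}, mixDensity f₀ f₁ π t x < ε)
    (hA1 : ∀ ε > 0, ∃ T : ℕ, ∀ t, T < t → ∀ i j : ℕ, 1 ≤ i → 1 ≤ j →
      ⌊(t : ℝ) - √(Real.log t) * ht t⌋ ≤ (i : ℤ) → i ≤ t →
      ⌊(t : ℝ) - √(Real.log t) * ht t⌋ ≤ (j : ℤ) → j ≤ t →
      ∫ x, |mixDensity f₀ f₁ π i x - mixDensity f₀ f₁ π j x| < ε)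
    (hA2 : Tendsto hx atTop (𝓝 0) ∧ (∀ t : ℕ, 1 ≤ t → ht t ≤ t) ∧
      Tendsto (fun t => hx t * ht t) atTop atTop)
    (hA3 : ∃ C : ℝ, ∀ j, 1 ≤ j →
      (∀ x, mixDensity f₀ f₁ π j x < C) ∧
      Differentiable ℝ (mixDensity f₀ f₁ π j) ∧
      Differentiable ℝ (deriv (mixDensity f₀ f₁ π j)) ∧
      Integrable (deriv (deriv (mixDensity f₀ f₁ π j))) ∧
      ∫ x, |deriv (deriv (mixDensity f₀ f₁ π j)) x| < C)
    (hA4 : ∃ c > 0, ∀ t, 1 ≤ t → c * ht t ≤ d t) :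
    TendstoInMeasure μ
      (fun (t : ℕ) ω => clfdrEst f₀ K ht hx d p τ (fun j => X j ω) t
        - min (clfdrTau μ X f₀ f₁ π p τ t ω) 1) atTop (fun _ => 0) ∧
    TendstoInMeasure μ
      (fun (t : ℕ) ω => clfdrRatioEst f₀ K ht hx d p τ (fun j => X j ω) t
        - clfdrTau μ X f₀ f₁ π p τ t ω) atTop (fun _ => 0) ∧
    ((∀ ε > 0, Tendsto (fun t : ℕ => μ {ω | 1 + ε < clfdrTau μ X f₀ f₁ π p τ t ω}) atTop (𝓝 0)) →
      TendstoInMeasure μ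
        (fun (t : ℕ) ω => clfdrEst f₀ K ht hx d p τ (fun j => X j ω) t
          - clfdrTau μ X f₀ f₁ π p τ t ω) atTop (fun _ => 0)) := by
  obtain ⟨hx0, -, hprod⟩ := hA2
  obtain ⟨C, hC⟩ := hA3
  obtain ⟨c, hc, hcd⟩ := hA4
  have hX := hmodel.isDensityModel
  have hC0 : 0 < C := ((hX.density 1 le_rfl).nonneg 0).trans_lt ((hC 1 le_rfl).1 0)
  -- Once `hx t ≤ 1`, the product `hx t * ht t` is at most `ht t`.
  have hlim : Tendsto ht atTop atTop := by
    refine tendsto_atTop_mono' _ ?_ hprod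
    filter_upwards [hx0.eventually_le_const one_pos, eventually_ge_atTop 1] with t h1 h2
    exact mul_le_of_le_one_left (hht t h2).le h1
  have hstable : RecentlyStable (mixDensity f₀ f₁ π) ht := by
    intro ε hε
    obtain ⟨T, hT⟩ := hA1 ε hε
    refine ⟨T, fun t htT j h1 h2 h3 => hT t htT j t h1 (h1.trans h3) h2 h3 ?_ le_rfl⟩
    have h4 : (t : ℝ) - √(Real.log t) * ht t ≤ ((t : ℤ) : ℝ) := by
      push_cast
      linarith [mul_nonneg (Real.sqrt_nonneg (Real.log t)) (hht t (h1.trans h3)).le]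
    exact_mod_cast (Int.floor_le _).trans h4
  have hratio := tendstoInMeasure_clfdrRatioEst_sub hX hmodel.density_null hp.measurable hτ₁ hK hd
    hhx hTight hx0 hlim hprod hc hcd hstable hC0 (L := 2 * C) (by positivity)
    (fun j hj x => ((hC j hj).1 x).le) fun j hj =>
      abs_sub_le_of_integral_abs_deriv_deriv_le (hX.density j hj).nonneg
        (fun x => ((hC j hj).1 x).le) (hC j hj).2.1 (hC j hj).2.2.1 (hC j hj).2.2.2.1
        (hC j hj).2.2.2.2.le
  have hmin : TendstoInMeasure μ
      (fun (t : ℕ) ω => clfdrEst f₀ K ht hx d p τ (fun j => X j ω) t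
        - min (clfdrTau μ X f₀ f₁ π p τ t ω) 1) atTop (fun _ => 0) := by
    rw [tendstoInMeasure_iff_norm] at hratio ⊢
    intro ε hε
    refine tendsto_of_tendsto_of_tendsto_of_le_of_le tendsto_const_nhds (hratio ε hε)
      (fun _ => zero_le) fun t => measure_mono fun ω hω => ?_
    simp only [Set.mem_ofPred_eq, sub_zero, Real.norm_eq_abs, clfdrEst] at hω ⊢
    refine hω.trans ((abs_min_sub_min_le_max _ _ _ _).trans_eq ?_)
    simp
  refine ⟨hmin, hratio, fun hexc => ?_⟩
  rw [tendstoInMeasure_iff_norm] at hmin ⊢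
  intro ε hε
  -- If the target is at most `1 + ε / 4`, truncation moves it by at most `ε / 4`, and `ε / 2 + ε /
  -- 4 < ε`.
  have hsum := (hmin (ε / 2) (half_pos hε)).add (hexc (ε / 4) (by positivity))
  rw [add_zero] at hsum
  refine tendsto_of_tendsto_of_tendsto_of_le_of_le tendsto_const_nhds hsum
    (fun _ => zero_le) fun t => (measure_mono fun ω hω => ?_).trans (measure_union_le _ _)
  by_contra hcon
  simp only [Set.mem_union, Set.mem_ofPred_eq, not_or, not_lt, not_le, sub_zero,
    Real.norm_eq_abs] at hcon hω
  obtain ⟨h1, h2⟩ := hcon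
  have h3 : |min (clfdrTau μ X f₀ f₁ π p τ t ω) 1 - clfdrTau μ X f₀ f₁ π p τ t ω| ≤ ε / 4 := by
    rw [abs_le]
    rcases min_cases (clfdrTau μ X f₀ f₁ π p τ t ω) 1 with ⟨h, -⟩ | ⟨h, h'⟩ <;> rw [h] <;>
      constructor <;> linarith
  have h4 := abs_sub_le (clfdrEst f₀ K ht hx d p τ (fun j => X j ω) t)
    (min (clfdrTau μ X f₀ f₁ π p τ t ω) 1) (clfdrTau μ X f₀ f₁ π p τ t ω)
  linarith
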